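/- Let $Y_0$ and $Y_1$ (the outcomes without and with the treatment) be real random variables on a common probability space, with arbitrary joint distribution. Let $F_j$ be the cumulative distribution function of $Y_j$ and $Q_j(p)=\inf\{x\in\mathbb{R}: p\le F_j(x)\}$, $0<p<1$, its quantile function ($j=0,1$). Let $U$ be a normalized rank of $Y_0$, that is, a random variable uniformly distributed on $[0,1]$ with $Y_0=Q_0(U)$ almost surely. Write $(x)_+=\max\{x,0\}$ and $(x)_-=(-x)_+$. Then for all $0\le a<b\le 1$: $$\int_a^b[Q_1(u-a)-Q_0(u)]\,du\le\mathbb{E}[(Y_1-Y_0)\mathbf{1}\{a<U<b\}]\le\int_a^b[Q_1(1+a-u)-Q_0(u)]\,du,\qquad(1)$$ $$\int_a^b[Q_1(u-a)-Q_0(u)]_+\,du\le\mathbb{E}[(Y_1-Y_0)_+\mathbf{1}\{a<U<b\}]\le\int_a^b[Q_1(1+a-u)-Q_0(u)]_+\,du,\qquad(2)$$ $$\int_a^b[Q_1(1-b+u)-Q_0(u)]_-\,du\le\mathbb{E}[(Y_1-Y_0)_-\mathbf{1}\{a<U<b\}]\le\int_a^b[Q_1(b-u)-Q_0(u)]_-\,du.\qquad(3)$$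 In particular, for every $0<b\le1$, $$\frac1b\int_0^b[Q_1(u)-Q_0(u)]\,du\le\mathbb{E}[Y_1-Y_0\mid U<b]\le\frac1b\int_0^b[Q_1(1-u)-Q_0(u)]\,du,\qquad(4)$$ so that the integrated quantile treatment effect is a lower bound on the subgroup average treatment effect, without any assumption on the dependence between $Y_0$ and $Y_1$. Here (2) and (3) hold in $[0,\infty]$ without any moment assumption. If $Y_0$ and $Y_1$ are integrable, then all integrals in (1) and (4) are finite. Without integrability, each inequality in (1) and (4) holds in $[-\infty,\infty]$ whenever both of its sides exist, that is, on each side the positive or the negative part has a finite integral. -/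

import Mathlib

open MeasureTheory ProbabilityTheory
open scoped ENNReal

noncomputable section

/-- The quantile function of a probability measure `ν` on `ℝ`: the left-continuous generalized
inverse `p ↦ inf {x | p ≤ F x}` of its cdf `F`. It is meaningful for `0 < p < 1`; these are the
only levels at which it is evaluated, up to Lebesgue-null sets. -/
def quantile (ν : Measure ℝ) (p : ℝ) : ℝ :=
  sInf {x : ℝ | p ≤ cdf ν x}

/-- `U` is a normalized rank of the random variable `Y`: it is uniformly distributed on `[0,1]`
and `Y = Q(U)` almost surely, where `Q` is the quantile function of `Y`. -/
structure IsNormalizedRank {Ω : Type*} [MeasurableSpace Ω] (μ : Measure Ω) (Y U : Ω → ℝ) :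
    Prop where
  measurable : Measurable U
  uniform : pdf.IsUniform U (Set.Icc 0 1) μ volume
  eq_quantile : ∀ᵐ ω ∂μ, Y ω = quantile (μ.map Y) (U ω)

/-- The integral of a measurable `f` exists in the extended sense: at least one of `∫ f⁺`
and `∫ f⁻` is finite. -/
def ExtIntegralExists {α : Type*} [MeasurableSpace α] (ν : Measure α) (f : α → ℝ) : Prop :=
  ∫⁻ x, ENNReal.ofReal ((f x)⁺) ∂ν ≠ ∞ ∨ ∫⁻ x, ENNReal.ofReal ((f x)⁻) ∂ν ≠ ∞

/-- The extended integral `∫ f⁺ - ∫ f⁻ ∈ [-∞, ∞]`, to be used when `ExtIntegralExists ν f`. -/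
def extIntegral {α : Type*} [MeasurableSpace α] (ν : Measure α) (f : α → ℝ) : EReal :=
  ((∫⁻ x, ENNReal.ofReal ((f x)⁺) ∂ν : ℝ≥0∞) : EReal) -
    ((∫⁻ x, ENNReal.ofReal ((f x)⁻) ∂ν : ℝ≥0∞) : EReal)

end

/-! Integrating `1{Y ≤ z < X}` over `z` gives `(X - Y)⁺`, so by `lintegral_posPart_sub` every
quantity in the theorem is an integral over levels `z` of masses of discordant regions. All bounds
then hold level by level. Fix `z`. Since `Y₀ ≤ z` means `U ≤ F₀ z` almost surely, the law of `Y₀`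
inside the subgroup is known, while `Y₁` is constrained only by its marginal: at most `F₁ z` of the
subgroup lies below `z` and at most `1 - F₁ z` above. `exists_discordant_masses` records this as a
2×2 table, whose discordant cells are thereby bounded. On the quantile side `quantile_le_iff` turns
the regions into explicit intervals of `u`, and their lengths are exactly the extreme values: giving
the subgroup the lowest or highest values of `Y₁`, in the same or the opposite order as `Y₀`, is
optimal at all levels at once. For the mean, the difference of the discordant cells is compared. The
inequality is kept in added form, free of `∞ - ∞`, and subtraction occurs only at the end. -/

/-! ### Layer-cake formula for positive and negative parts. -/

section LayerCake

variable {α : Type*} [MeasurableSpace α]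

/-- Tonelli for the region between the graphs of `Y` and `X`, sliced vertically and horizontally. -/
theorem lintegral_posPart_sub (ν : Measure α) [SFinite ν] {X Y : α → ℝ}
    (hX : AEMeasurable X ν) (hY : AEMeasurable Y ν) :
    ∫⁻ x, ENNReal.ofReal ((X x - Y x)⁺) ∂ν = ∫⁻ z : ℝ, ν {x | Y x ≤ z ∧ z < X x} := by
  have hS : MeasurableSet {p : α × ℝ | hY.mk Y p.1 ≤ p.2 ∧ p.2 < hX.mk X p.1} :=
    (measurableSet_le (hY.measurable_mk.comp measurable_fst) measurable_snd).inter
      (measurableSet_lt measurable_snd (hX.measurable_mk.comp measurable_fst))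
  calc ∫⁻ x, ENNReal.ofReal ((X x - Y x)⁺) ∂ν
      = ∫⁻ x, volume (Set.Ico (hY.mk Y x) (hX.mk X x)) ∂ν := by
        refine lintegral_congr_ae ?_
        filter_upwards [hX.ae_eq_mk, hY.ae_eq_mk] with x hx hy
        rw [Real.volume_Ico, ← hx, ← hy, posPart_def]
        simp
    _ = (ν.prod volume) {p : α × ℝ | hY.mk Y p.1 ≤ p.2 ∧ p.2 < hX.mk X p.1} :=
        (Measure.prod_apply hS).symm
    _ = ∫⁻ z : ℝ, ν {x | hY.mk Y x ≤ z ∧ z < hX.mk X x} := Measure.prod_apply_symm hS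
    _ = ∫⁻ z : ℝ, ν {x | Y x ≤ z ∧ z < X x} := by
        refine lintegral_congr fun z => measure_congr ?_
        filter_upwards [hX.ae_eq_mk, hY.ae_eq_mk] with x hx hy
        exact propext (show _ ∧ _ ↔ _ ∧ _ by rw [hx, hy])

theorem lintegral_negPart_sub (ν : Measure α) [SFinite ν] {X Y : α → ℝ}
    (hX : AEMeasurable X ν) (hY : AEMeasurable Y ν) :
    ∫⁻ x, ENNReal.ofReal ((X x - Y x)⁻) ∂ν = ∫⁻ z : ℝ, ν {x | X x ≤ z ∧ z < Y x} := by
  rw [← lintegral_posPart_sub ν hY hX]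
  refine lintegral_congr fun x => ?_
  rw [← posPart_neg, neg_sub]

theorem measurable_measure_between (ν : Measure α) [SFinite ν] {X Y : α → ℝ}
    (hX : AEMeasurable X ν) (hY : AEMeasurable Y ν) :
    Measurable fun z : ℝ => ν {x | Y x ≤ z ∧ z < X x} := by
  have hS : MeasurableSet {p : α × ℝ | hY.mk Y p.1 ≤ p.2 ∧ p.2 < hX.mk X p.1} :=
    (measurableSet_le (hY.measurable_mk.comp measurable_fst) measurable_snd).inter
      (measurableSet_lt measurable_snd (hX.measurable_mk.comp measurable_fst))
  convert measurable_measure_prodMk_right (μ := ν) hS using 2 with z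
  refine measure_congr ?_
  filter_upwards [hX.ae_eq_mk, hY.ae_eq_mk] with x hx hy
  exact propext (show _ ∧ _ ↔ _ ∧ _ by rw [hx, hy])

end LayerCake

/-! ### From added inequalities to extended and Bochner integrals. -/

section ExtIntegral

variable {α β : Type*} [MeasurableSpace α] [MeasurableSpace β]

/-- Existence of both integrals excludes `∞ - ∞`. An infinite term on the left of `h` forces one on
the right, so in each remaining case the left side is `⊥`, the right side is `⊤`, or all four terms
are finite. -/
theorem extIntegral_le_of_add_le {ν : Measure α} {κ : Measure β} {f : α → ℝ} {g : β → ℝ}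
    (hf : ExtIntegralExists ν f) (hg : ExtIntegralExists κ g)
    (h : ∫⁻ x, ENNReal.ofReal ((f x)⁺) ∂ν + ∫⁻ y, ENNReal.ofReal ((g y)⁻) ∂κ ≤
      ∫⁻ y, ENNReal.ofReal ((g y)⁺) ∂κ + ∫⁻ x, ENNReal.ofReal ((f x)⁻) ∂ν) :
    extIntegral ν f ≤ extIntegral κ g := by
  unfold extIntegral
  unfold ExtIntegralExists at hf hg
  generalize ∫⁻ x, ENNReal.ofReal ((f x)⁺) ∂ν = p at *
  generalize ∫⁻ x, ENNReal.ofReal ((f x)⁻) ∂ν = q at *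
  generalize ∫⁻ x, ENNReal.ofReal ((g x)⁺) ∂κ = r at *
  generalize ∫⁻ x, ENNReal.ofReal ((g x)⁻) ∂κ = s at *
  induction r with
  | top =>
    induction s with
    | top => simp at hg
    | coe s =>
      rw [EReal.coe_ennreal_top, EReal.coe_nnreal_eq_coe_real, EReal.top_sub_coe]
      exact le_top
  | coe r =>
    induction q with
    | top =>
      induction p with
      | top => simp at hf
      | coe p => simp
    | coe q =>
      induction p with
      | top => simp [← ENNReal.coe_add] at h
      | coe p =>
        induction s with
        | top => simp [← ENNReal.coe_add] at h
        | coe s =>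
          have h' : (p : ℝ) + s ≤ r + q := by exact_mod_cast h
          have : (p : ℝ) - q ≤ r - s := by linarith
          simp only [EReal.coe_nnreal_eq_coe_real]
          exact_mod_cast this

theorem extIntegral_smul {c : ℝ} (hc : 0 ≤ c) (ν : Measure α) (f : α → ℝ) :
    extIntegral (ENNReal.ofReal c • ν) f = (c : EReal) * extIntegral ν f := by
  have h0 : ((ENNReal.ofReal c : ℝ≥0∞) : EReal) = c := by
    rw [EReal.coe_ennreal_ofReal, max_eq_left hc]
  unfold extIntegral
  rw [lintegral_smul_measure, lintegral_smul_measure, smul_eq_mul, smul_eq_mul,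
    EReal.coe_ennreal_mul, EReal.coe_ennreal_mul, h0, sub_eq_add_neg, sub_eq_add_neg,
    EReal.left_distrib_of_nonneg_of_ne_top (by exact_mod_cast hc) (EReal.coe_ne_top c), mul_neg]

theorem extIntegralExists_smul_iff {c : ℝ≥0∞} (hc : c ≠ 0) (hc' : c ≠ ∞) (ν : Measure α)
    (f : α → ℝ) : ExtIntegralExists (c • ν) f ↔ ExtIntegralExists ν f := by
  simp [ExtIntegralExists, lintegral_smul_measure, ENNReal.mul_eq_top, hc, hc']

theorem integral_le_integral_of_add_le {ν : Measure α} {κ : Measure β} {f : α → ℝ} {g : β → ℝ}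
    (hf : Integrable f ν) (hg : Integrable g κ)
    (h : ∫⁻ x, ENNReal.ofReal ((f x)⁺) ∂ν + ∫⁻ y, ENNReal.ofReal ((g y)⁻) ∂κ ≤
      ∫⁻ y, ENNReal.ofReal ((g y)⁺) ∂κ + ∫⁻ x, ENNReal.ofReal ((f x)⁻) ∂ν) :
    ∫ x, f x ∂ν ≤ ∫ y, g y ∂κ := by
  have e1 : ∀ t : ℝ, ENNReal.ofReal (t⁺) = ENNReal.ofReal t := fun t => by simp [posPart_def]
  have e2 : ∀ t : ℝ, ENNReal.ofReal (t⁻) = ENNReal.ofReal (-t) := fun t => by simp [negPart_def]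
  simp only [e1, e2] at h
  rw [integral_eq_lintegral_pos_part_sub_lintegral_neg_part hf,
    integral_eq_lintegral_pos_part_sub_lintegral_neg_part hg, sub_le_sub_iff]
  have a1 := hf.lintegral_lt_top.ne
  have a2 := hf.neg.lintegral_lt_top.ne
  have b1 := hg.lintegral_lt_top.ne
  have b2 := hg.neg.lintegral_lt_top.ne
  simp only [Pi.neg_apply] at a2 b2
  rw [← ENNReal.toReal_add a1 b2, ← ENNReal.toReal_add b1 a2]
  exact ENNReal.toReal_mono (ENNReal.add_ne_top.2 ⟨b1, a2⟩) h

end ExtIntegral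

/-! ### Quantile functions and the lengths of their level regions. -/

section Quantile

variable (ν : Measure ℝ)

/-- Galois connection between quantile and cdf. Right continuity of the cdf makes the infimum
attained; `0 < p < 1` makes the set bounded below and nonempty, so that `sInf` is not a default
value. -/
theorem quantile_le_iff {p : ℝ} (hp0 : 0 < p) (hp1 : p < 1) (z : ℝ) :
    quantile ν p ≤ z ↔ p ≤ cdf ν z := by
  have hbdd : BddBelow {x : ℝ | p ≤ cdf ν x} := by
    obtain ⟨m, hm⟩ := ((tendsto_cdf_atBot ν).eventually (gt_mem_nhds hp0)).exists
    refine ⟨m, fun x hx => ?_⟩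
    by_contra hlt
    exact absurd ((show p ≤ cdf ν x from hx).trans (monotone_cdf ν (not_le.1 hlt).le)) (not_le.2 hm)
  have hne : {x : ℝ | p ≤ cdf ν x}.Nonempty := by
    obtain ⟨m, hm⟩ := ((tendsto_cdf_atTop ν).eventually (lt_mem_nhds hp1)).exists
    exact ⟨m, hm.le⟩
  constructor
  · intro h
    refine ge_of_tendsto (((cdf ν).right_continuous z).mono Set.Ioi_subset_Ici_self)
      (Filter.eventually_of_mem self_mem_nhdsWithin fun w hw => ?_)
    obtain ⟨x, hx, hxw⟩ := (csInf_lt_iff hbdd hne).1 (lt_of_le_of_lt h hw)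
    exact (show p ≤ cdf ν x from hx).trans (monotone_cdf ν hxw.le)
  · exact fun h => csInf_le hbdd h

theorem lt_quantile_iff {p : ℝ} (hp0 : 0 < p) (hp1 : p < 1) (z : ℝ) :
    z < quantile ν p ↔ cdf ν z < p := by
  rw [← not_le, quantile_le_iff ν hp0 hp1, not_le]

theorem monotoneOn_quantile : MonotoneOn (quantile ν) (Set.Ioo 0 1) := fun _ hp _ hq hpq =>
  (quantile_le_iff ν hp.1 hp.2 _).2 (hpq.trans ((quantile_le_iff ν hq.1 hq.2 _).1 le_rfl))

theorem aemeasurable_quantile_sub {a b τ : ℝ} (ha : 0 ≤ a - τ) (hb : b - τ ≤ 1) :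
    AEMeasurable (fun u => quantile ν (u - τ)) (volume.restrict (Set.Ioo a b)) := by
  refine aemeasurable_restrict_of_monotoneOn measurableSet_Ioo fun u hu v hv huv => ?_
  rw [Set.mem_Ioo] at hu hv
  exact monotoneOn_quantile ν ⟨by linarith, by linarith⟩ ⟨by linarith, by linarith⟩ (by linarith)

theorem aemeasurable_quantile_const_sub {a b τ : ℝ} (hb : 0 ≤ τ - b) (ha : τ - a ≤ 1) :
    AEMeasurable (fun u => quantile ν (τ - u)) (volume.restrict (Set.Ioo a b)) := by
  refine aemeasurable_restrict_of_antitoneOn measurableSet_Ioo fun u hu v hv huv => ?_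
  rw [Set.mem_Ioo] at hu hv
  exact monotoneOn_quantile ν ⟨by linarith, by linarith⟩ ⟨by linarith, by linarith⟩ (by linarith)

/-- Makes endpoints irrelevant below. It also covers `r ≤ l`, where `ENNReal.ofReal` truncates to
`0`. -/
theorem Real.volume_eq_of_Ioo_subset_of_subset_Icc {l r : ℝ} {s : Set ℝ} (h₁ : Set.Ioo l r ⊆ s)
    (h₂ : s ⊆ Set.Icc l r) : volume s = ENNReal.ofReal (r - l) :=
  le_antisymm ((measure_mono h₂).trans_eq Real.volume_Icc)
    (Real.volume_Ioo.symm.trans_le (measure_mono h₁))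

/-- Inverse transform sampling; it transfers integrability from a law to its quantile function. -/
theorem map_quantile [IsProbabilityMeasure ν] :
    (volume.restrict (Set.Ioo 0 1)).map (quantile ν) = ν := by
  have hQ : AEMeasurable (quantile ν) (volume.restrict (Set.Ioo 0 1)) :=
    aemeasurable_restrict_of_monotoneOn measurableSet_Ioo (monotoneOn_quantile ν)
  refine Measure.ext_of_Iic _ _ fun z => ?_
  rw [Measure.map_apply_of_aemeasurable hQ measurableSet_Iic,
    Measure.restrict_apply' measurableSet_Ioo, ← ofReal_cdf,
    Real.volume_eq_of_Ioo_subset_of_subset_Icc (l := 0) (r := cdf ν z), sub_zero]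
  · intro u hu
    have hu' : u ∈ Set.Ioo (0 : ℝ) 1 := ⟨hu.1, hu.2.trans_le (cdf_le_one ν z)⟩
    exact ⟨(quantile_le_iff ν hu'.1 hu'.2 z).2 hu.2.le, hu'⟩
  · rintro u ⟨hu, hu'⟩
    exact ⟨hu'.1.le, (quantile_le_iff ν hu'.1 hu'.2 z).1 hu⟩

theorem intervalIntegrable_quantile [IsProbabilityMeasure ν] (h : Integrable id ν) :
    IntervalIntegrable (quantile ν) volume 0 1 := by
  rw [intervalIntegrable_iff_integrableOn_Ioo_of_le zero_le_one]
  have hQ : AEMeasurable (quantile ν) (volume.restrict (Set.Ioo 0 1)) :=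
    aemeasurable_restrict_of_monotoneOn measurableSet_Ioo (monotoneOn_quantile ν)
  rw [← map_quantile ν] at h
  exact (integrable_map_measure aestronglyMeasurable_id hQ).1 h

variable (κ : Measure ℝ) {a b τ : ℝ}

/-- The bounds on `a`, `b`, `τ` keep both quantile levels in `(0,1)`, where the region is `τ + cdf ν
z < u ≤ cdf κ z`. -/
theorem volume_quantile_le_lt_quantile_sub (ha : 0 ≤ a) (hb : b ≤ 1) (ha' : 0 ≤ a - τ)
    (hb' : b - τ ≤ 1) (z : ℝ) :
    volume.restrict (Set.Ioo a b) {u | quantile κ u ≤ z ∧ z < quantile ν (u - τ)} =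
      ENNReal.ofReal (min b (cdf κ z) - max a (τ + cdf ν z)) := by
  rw [Measure.restrict_apply' measurableSet_Ioo]
  refine Real.volume_eq_of_Ioo_subset_of_subset_Icc (fun u hu => ?_) ?_
  · simp only [Set.mem_Ioo, max_lt_iff, lt_min_iff] at hu
    refine ⟨⟨(quantile_le_iff κ ?_ ?_ z).2 ?_, (lt_quantile_iff ν ?_ ?_ z).2 ?_⟩, ?_, ?_⟩ <;> linarith
  · rintro u ⟨⟨h0, h1⟩, hu, hu'⟩
    have h0' := (quantile_le_iff κ (by linarith) (by linarith) z).1 h0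
    have h1' := (lt_quantile_iff ν (by linarith) (by linarith) z).1 h1
    exact ⟨max_le hu.le (by linarith), le_min hu'.le h0'⟩

theorem volume_quantile_sub_le_lt_quantile (ha : 0 ≤ a) (hb : b ≤ 1) (ha' : 0 ≤ a - τ)
    (hb' : b - τ ≤ 1) (z : ℝ) :
    volume.restrict (Set.Ioo a b) {u | quantile ν (u - τ) ≤ z ∧ z < quantile κ u} =
      ENNReal.ofReal (min b (τ + cdf ν z) - max a (cdf κ z)) := by
  rw [Measure.restrict_apply' measurableSet_Ioo]
  refine Real.volume_eq_of_Ioo_subset_of_subset_Icc (fun u hu => ?_) ?_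
  · simp only [Set.mem_Ioo, max_lt_iff, lt_min_iff] at hu
    refine ⟨⟨(quantile_le_iff ν ?_ ?_ z).2 ?_, (lt_quantile_iff κ ?_ ?_ z).2 ?_⟩, ?_, ?_⟩ <;> linarith
  · rintro u ⟨⟨h1, h0⟩, hu, hu'⟩
    have h0' := (lt_quantile_iff κ (by linarith) (by linarith) z).1 h0
    have h1' := (quantile_le_iff ν (by linarith) (by linarith) z).1 h1
    exact ⟨max_le hu.le h0'.le, le_min hu'.le (by linarith)⟩

/-- With the order reversed, both conditions bound `u` from above. -/
theorem volume_quantile_le_lt_quantile_const_sub (ha : 0 ≤ a) (hb : b ≤ 1) (hb' : 0 ≤ τ - b)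
    (ha' : τ - a ≤ 1) (z : ℝ) :
    volume.restrict (Set.Ioo a b) {u | quantile κ u ≤ z ∧ z < quantile ν (τ - u)} =
      ENNReal.ofReal (min b (min (cdf κ z) (τ - cdf ν z)) - a) := by
  rw [Measure.restrict_apply' measurableSet_Ioo]
  refine Real.volume_eq_of_Ioo_subset_of_subset_Icc (fun u hu => ?_) ?_
  · simp only [Set.mem_Ioo, lt_min_iff] at hu
    refine ⟨⟨(quantile_le_iff κ ?_ ?_ z).2 ?_, (lt_quantile_iff ν ?_ ?_ z).2 ?_⟩, ?_, ?_⟩ <;> linarith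
  · rintro u ⟨⟨h0, h1⟩, hu, hu'⟩
    have h0' := (quantile_le_iff κ (by linarith) (by linarith) z).1 h0
    have h1' := (lt_quantile_iff ν (by linarith) (by linarith) z).1 h1
    exact ⟨hu.le, le_min hu'.le (le_min h0' (by linarith))⟩

theorem volume_quantile_const_sub_le_lt_quantile (ha : 0 ≤ a) (hb : b ≤ 1) (hb' : 0 ≤ τ - b)
    (ha' : τ - a ≤ 1) (z : ℝ) :
    volume.restrict (Set.Ioo a b) {u | quantile ν (τ - u) ≤ z ∧ z < quantile κ u} =
      ENNReal.ofReal (b - max a (max (cdf κ z) (τ - cdf ν z))) := by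
  rw [Measure.restrict_apply' measurableSet_Ioo]
  refine Real.volume_eq_of_Ioo_subset_of_subset_Icc (fun u hu => ?_) ?_
  · simp only [Set.mem_Ioo, max_lt_iff] at hu
    refine ⟨⟨(quantile_le_iff ν ?_ ?_ z).2 ?_, (lt_quantile_iff κ ?_ ?_ z).2 ?_⟩, ?_, ?_⟩ <;> linarith
  · rintro u ⟨⟨h1, h0⟩, hu, hu'⟩
    have h0' := (lt_quantile_iff κ (by linarith) (by linarith) z).1 h0
    have h1' := (quantile_le_iff ν (by linarith) (by linarith) z).1 h1
    exact ⟨max_le hu.le (max_le h0'.le (by linarith)), hu'.le⟩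

end Quantile

section Arithmetic

theorem ENNReal.ofReal_add_le_ofReal_add {p q r s : ℝ}
    (h : max p 0 + max q 0 ≤ max r 0 + max s 0) :
    ENNReal.ofReal p + ENNReal.ofReal q ≤ ENNReal.ofReal r + ENNReal.ofReal s := by
  have e : ∀ t : ℝ, ENNReal.ofReal t = ENNReal.ofReal (max t 0) := fun t => by simp
  rw [e p, e q, e r, e s, ← ENNReal.ofReal_add (le_max_right _ _) (le_max_right _ _),
    ← ENNReal.ofReal_add (le_max_right _ _) (le_max_right _ _)]
  exact ENNReal.ofReal_le_ofReal h

end Arithmetic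

/-! ### Discordant masses in a rank subgroup and the level-wise bounds. -/

section Rank

variable {Ω : Type*} [MeasurableSpace Ω] {μ : Measure Ω} {Y₀ Y₁ U : Ω → ℝ}

namespace IsNormalizedRank

theorem map_eq (hU : IsNormalizedRank μ Y₀ U) : μ.map U = volume.restrict (Set.Ioo 0 1) := by
  rw [show μ.map U = cond volume (Set.Icc 0 1) from hU.uniform, ProbabilityTheory.cond,
    Real.volume_Icc, sub_zero, ENNReal.ofReal_one, inv_one, one_smul]
  exact Measure.restrict_congr_set Ioo_ae_eq_Icc.symm

theorem ae_mem_Ioo (hU : IsNormalizedRank μ Y₀ U) : ∀ᵐ ω ∂μ, U ω ∈ Set.Ioo (0 : ℝ) 1 := by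
  refine ae_of_ae_map hU.measurable.aemeasurable ?_
  rw [hU.map_eq]
  exact ae_restrict_mem measurableSet_Ioo

/-- Almost surely `Y₀ ≤ z` is the event `U ≤ F₀ z`, so the set is an interval of ranks. -/
theorem measure_le [IsProbabilityMeasure μ] (hU : IsNormalizedRank μ Y₀ U) {a b : ℝ} (ha : 0 ≤ a) (hb : b ≤ 1) (z : ℝ) :
    μ.restrict {ω | a < U ω ∧ U ω < b} {ω | Y₀ ω ≤ z} =
      ENNReal.ofReal (min b (cdf (μ.map Y₀) z) - a) := by
  have hA : MeasurableSet {ω | a < U ω ∧ U ω < b} := hU.measurable measurableSet_Ioo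
  have hS : MeasurableSet (Set.Ioo a b ∩ Set.Iic (cdf (μ.map Y₀) z)) :=
    measurableSet_Ioo.inter measurableSet_Iic
  have hae : ({ω | Y₀ ω ≤ z} ∩ {ω | a < U ω ∧ U ω < b} : Set Ω) =ᵐ[μ]
      U ⁻¹' (Set.Ioo a b ∩ Set.Iic (cdf (μ.map Y₀) z)) := by
    filter_upwards [hU.eq_quantile, hU.ae_mem_Ioo] with ω h h'
    refine propext (show _ ∧ _ ↔ _ ∧ _ from ?_)
    simp only [Set.mem_ofPred_eq, h, quantile_le_iff _ h'.1 h'.2, Set.mem_Ioo, Set.mem_Iic]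
    exact and_comm
  rw [Measure.restrict_apply' hA, measure_congr hae, ← Measure.map_apply hU.measurable hS,
    hU.map_eq, Measure.restrict_apply hS]
  refine Real.volume_eq_of_Ioo_subset_of_subset_Icc (fun u hu => ?_) ?_
  · simp only [Set.mem_Ioo, lt_min_iff] at hu
    exact ⟨⟨⟨hu.1, hu.2.1⟩, hu.2.2.le⟩, by linarith, by linarith⟩
  · rintro u ⟨⟨hu, hu'⟩, -⟩
    exact ⟨hu.1.le, le_min hu.2.le hu'⟩

theorem measure_subgroup (hU : IsNormalizedRank μ Y₀ U) {a b : ℝ} (ha : 0 ≤ a) (hb : b ≤ 1) :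
    μ {ω | a < U ω ∧ U ω < b} = ENNReal.ofReal (b - a) := by
  rw [show {ω | a < U ω ∧ U ω < b} = U ⁻¹' Set.Ioo a b from rfl,
    ← Measure.map_apply hU.measurable measurableSet_Ioo, hU.map_eq,
    Measure.restrict_apply measurableSet_Ioo,
    Set.inter_eq_left.2 (Set.Ioo_subset_Ioo ha hb), Real.volume_Ioo]

end IsNormalizedRank

variable [IsProbabilityMeasure μ]

/-- At every level `z`, the masses of the two discordant regions `Y₀ ≤ z < Y₁` and `Y₁ ≤ z < Y₀`
within the subgroup `a < U < b`, together with the constraints imposed by the marginal laws. -/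
theorem exists_discordant_masses (hY₀ : Measurable Y₀) (hY₁ : Measurable Y₁)
    (hU : IsNormalizedRank μ Y₀ U) {a b : ℝ} (ha : 0 ≤ a) (hab : a < b) (hb : b ≤ 1) (z : ℝ) :
    ∃ x y p s : ℝ, 0 ≤ x ∧ 0 ≤ y ∧ 0 ≤ p ∧ 0 ≤ s ∧
      μ.restrict {ω | a < U ω ∧ U ω < b} {ω | Y₀ ω ≤ z ∧ z < Y₁ ω} = ENNReal.ofReal x ∧
      μ.restrict {ω | a < U ω ∧ U ω < b} {ω | Y₁ ω ≤ z ∧ z < Y₀ ω} = ENNReal.ofReal y ∧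
      x + p = max (min b (cdf (μ.map Y₀) z) - a) 0 ∧ x + p + y + s = b - a ∧
      p + y ≤ cdf (μ.map Y₁) z ∧ x + s ≤ 1 - cdf (μ.map Y₁) z := by
  set κ := μ.restrict {ω | a < U ω ∧ U ω < b} with hκ
  have h0 : MeasurableSet {ω | Y₀ ω ≤ z} := hY₀ measurableSet_Iic
  have h1 : MeasurableSet {ω | Y₁ ω ≤ z} := hY₁ measurableSet_Iic
  have hprob : IsProbabilityMeasure (μ.map Y₁) := Measure.isProbabilityMeasure_map hY₁.aemeasurable
  have hF : cdf (μ.map Y₁) z = μ.real {ω | Y₁ ω ≤ z} := by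
    rw [cdf_eq_real, map_measureReal_apply hY₁ measurableSet_Iic]; rfl
  have hxset : {ω | Y₀ ω ≤ z ∧ z < Y₁ ω} = {ω | Y₀ ω ≤ z} \ {ω | Y₁ ω ≤ z} := by
    ext ω; simp
  have hyset : {ω | Y₁ ω ≤ z ∧ z < Y₀ ω} = {ω | Y₁ ω ≤ z} \ {ω | Y₀ ω ≤ z} := by
    ext ω; simp
  have hle : ∀ t : Set Ω, κ.real t ≤ μ.real t := fun t =>
    ENNReal.toReal_mono (measure_ne_top _ _) (Measure.restrict_apply_le _ t)
  -- The four cells of the table: `p` has both outcomes at most `z`, `s` has both above.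
  refine ⟨κ.real ({ω | Y₀ ω ≤ z} \ {ω | Y₁ ω ≤ z}), κ.real ({ω | Y₁ ω ≤ z} \ {ω | Y₀ ω ≤ z}),
    κ.real ({ω | Y₀ ω ≤ z} ∩ {ω | Y₁ ω ≤ z}), κ.real ({ω | Y₀ ω ≤ z}ᶜ \ {ω | Y₁ ω ≤ z}),
    measureReal_nonneg, measureReal_nonneg, measureReal_nonneg, measureReal_nonneg, ?_, ?_, ?_, ?_,
    ?_, ?_⟩
  · rw [hxset, ofReal_measureReal]
  · rw [hyset, ofReal_measureReal]
  · rw [add_comm, measureReal_inter_add_sdiff h1, measureReal_def, hU.measure_le ha hb z,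
      ENNReal.toReal_ofReal']
  · have e1 := measureReal_inter_add_sdiff (μ := κ) (s := {ω | Y₀ ω ≤ z}) h1
    have e2 := measureReal_inter_add_sdiff (μ := κ) (s := {ω | Y₀ ω ≤ z}ᶜ) h1
    have e3 := measureReal_compl (μ := κ) h0
    have e4 : κ.real Set.univ = b - a := by
      rw [measureReal_def, hκ, Measure.restrict_apply_univ, hU.measure_subgroup ha hb,
        ENNReal.toReal_ofReal (by linarith)]
    have e5 : {ω | Y₁ ω ≤ z} \ {ω | Y₀ ω ≤ z} = {ω | Y₀ ω ≤ z}ᶜ ∩ {ω | Y₁ ω ≤ z} := by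
      ext ω; simp [and_comm]
    rw [e5]
    linarith
  · rw [Set.inter_comm, measureReal_inter_add_sdiff h0, hF]
    exact hle _
  · have e1 := measureReal_inter_add_sdiff (μ := κ) (s := {ω | Y₁ ω ≤ z}ᶜ) h0
    have e2 := measureReal_compl (μ := μ) h1
    rw [probReal_univ] at e2
    have e3 : {ω | Y₁ ω ≤ z}ᶜ ∩ {ω | Y₀ ω ≤ z} = {ω | Y₀ ω ≤ z} \ {ω | Y₁ ω ≤ z} := by
      ext ω; simp [and_comm]
    have e4 : {ω | Y₁ ω ≤ z}ᶜ \ {ω | Y₀ ω ≤ z} = {ω | Y₀ ω ≤ z}ᶜ \ {ω | Y₁ ω ≤ z} := by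
      ext ω; simp [and_comm]
    rw [e3, e4] at e1
    rw [e1, hF, ← e2]
    exact hle _

variable {a b : ℝ}

/-- Level-wise, `x = (x + p) - p` and `p ≤ F₁ z`. -/
theorem lintegral_posPart_quantile_sub_le (hY₀ : Measurable Y₀) (hY₁ : Measurable Y₁)
    (hU : IsNormalizedRank μ Y₀ U) (ha : 0 ≤ a) (hab : a < b) (hb : b ≤ 1) :
    ∫⁻ u in Set.Ioo a b,
        ENNReal.ofReal ((quantile (μ.map Y₁) (u - a) - quantile (μ.map Y₀) u)⁺) ≤
      ∫⁻ ω in {ω | a < U ω ∧ U ω < b}, ENNReal.ofReal ((Y₁ ω - Y₀ ω)⁺) ∂μ := by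
  have hQ₀ := aemeasurable_quantile_sub (μ.map Y₀) (a := a) (b := b) (τ := 0) (by simpa) (by simpa)
  simp only [sub_zero] at hQ₀
  rw [lintegral_posPart_sub _ (aemeasurable_quantile_sub _ (by linarith) (by linarith)) hQ₀,
    lintegral_posPart_sub _ hY₁.aemeasurable hY₀.aemeasurable]
  refine lintegral_mono fun z => ?_
  obtain ⟨x, y, p, s, hx, hy, hp, hs, hD, -, h1, h2, h3, h4⟩ :=
    exists_discordant_masses hY₀ hY₁ hU ha hab hb z
  simp only [hD, volume_quantile_le_lt_quantile_sub _ _ ha hb (by linarith : 0 ≤ a - a)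
    (by linarith)]
  rw [ENNReal.ofReal_le_ofReal_iff']
  have := cdf_nonneg (μ.map Y₁) z
  left
  grind

/-- Level-wise, `x` is at most `x + p` and at most `1 - F₁ z`. -/
theorem lintegral_posPart_le_quantile_const_sub (hY₀ : Measurable Y₀) (hY₁ : Measurable Y₁)
    (hU : IsNormalizedRank μ Y₀ U) (ha : 0 ≤ a) (hab : a < b) (hb : b ≤ 1) :
    ∫⁻ ω in {ω | a < U ω ∧ U ω < b}, ENNReal.ofReal ((Y₁ ω - Y₀ ω)⁺) ∂μ ≤
      ∫⁻ u in Set.Ioo a b,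
        ENNReal.ofReal ((quantile (μ.map Y₁) (1 + a - u) - quantile (μ.map Y₀) u)⁺) := by
  have hQ₀ := aemeasurable_quantile_sub (μ.map Y₀) (a := a) (b := b) (τ := 0) (by simpa) (by simpa)
  simp only [sub_zero] at hQ₀
  rw [lintegral_posPart_sub _ (aemeasurable_quantile_const_sub _ (by linarith) (by linarith)) hQ₀,
    lintegral_posPart_sub _ hY₁.aemeasurable hY₀.aemeasurable]
  refine lintegral_mono fun z => ?_
  obtain ⟨x, y, p, s, hx, hy, hp, hs, hD, -, h1, h2, h3, h4⟩ :=
    exists_discordant_masses hY₀ hY₁ hU ha hab hb z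
  simp only [hD, volume_quantile_le_lt_quantile_const_sub _ _ ha hb
    (by linarith : 0 ≤ 1 + a - b) (by linarith)]
  rw [ENNReal.ofReal_le_ofReal_iff']
  have := cdf_nonneg (μ.map Y₁) z
  grind

/-- Level-wise, `y = (y + s) - s` and `s ≤ 1 - F₁ z`. The shift `b - 1` assigns the top `b - a` of
the law of `Y₁` to the subgroup. -/
theorem lintegral_negPart_quantile_sub_le (hY₀ : Measurable Y₀) (hY₁ : Measurable Y₁)
    (hU : IsNormalizedRank μ Y₀ U) (ha : 0 ≤ a) (hab : a < b) (hb : b ≤ 1) :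
    ∫⁻ u in Set.Ioo a b,
        ENNReal.ofReal ((quantile (μ.map Y₁) (u - (b - 1)) - quantile (μ.map Y₀) u)⁻) ≤
      ∫⁻ ω in {ω | a < U ω ∧ U ω < b}, ENNReal.ofReal ((Y₁ ω - Y₀ ω)⁻) ∂μ := by
  have hQ₀ := aemeasurable_quantile_sub (μ.map Y₀) (a := a) (b := b) (τ := 0) (by simpa) (by simpa)
  simp only [sub_zero] at hQ₀
  rw [lintegral_negPart_sub _ (aemeasurable_quantile_sub _ (by linarith) (by linarith)) hQ₀,
    lintegral_negPart_sub _ hY₁.aemeasurable hY₀.aemeasurable]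
  refine lintegral_mono fun z => ?_
  obtain ⟨x, y, p, s, hx, hy, hp, hs, -, hD, h1, h2, h3, h4⟩ :=
    exists_discordant_masses hY₀ hY₁ hU ha hab hb z
  simp only [hD, volume_quantile_sub_le_lt_quantile _ _ ha hb (by linarith : 0 ≤ a - (b - 1))
    (by linarith)]
  rw [ENNReal.ofReal_le_ofReal_iff']
  have := cdf_le_one (μ.map Y₁) z
  grind

/-- Level-wise, `y` is at most `y + s` and at most `F₁ z`. -/
theorem lintegral_negPart_le_quantile_const_sub (hY₀ : Measurable Y₀) (hY₁ : Measurable Y₁)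
    (hU : IsNormalizedRank μ Y₀ U) (ha : 0 ≤ a) (hab : a < b) (hb : b ≤ 1) :
    ∫⁻ ω in {ω | a < U ω ∧ U ω < b}, ENNReal.ofReal ((Y₁ ω - Y₀ ω)⁻) ∂μ ≤
      ∫⁻ u in Set.Ioo a b,
        ENNReal.ofReal ((quantile (μ.map Y₁) (b - u) - quantile (μ.map Y₀) u)⁻) := by
  have hQ₀ := aemeasurable_quantile_sub (μ.map Y₀) (a := a) (b := b) (τ := 0) (by simpa) (by simpa)
  simp only [sub_zero] at hQ₀
  rw [lintegral_negPart_sub _ (aemeasurable_quantile_const_sub _ (by linarith) (by linarith)) hQ₀,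
    lintegral_negPart_sub _ hY₁.aemeasurable hY₀.aemeasurable]
  refine lintegral_mono fun z => ?_
  obtain ⟨x, y, p, s, hx, hy, hp, hs, -, hD, h1, h2, h3, h4⟩ :=
    exists_discordant_masses hY₀ hY₁ hU ha hab hb z
  simp only [hD, volume_quantile_const_sub_le_lt_quantile _ _ ha hb (by linarith : 0 ≤ b - b)
    (by linarith)]
  rw [ENNReal.ofReal_le_ofReal_iff']
  have := cdf_le_one (μ.map Y₁) z
  grind

/-- The lower bound on the mean effect in a form that makes sense without moment assumptions. -/
theorem lintegral_quantile_sub_add_le (hY₀ : Measurable Y₀) (hY₁ : Measurable Y₁)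
    (hU : IsNormalizedRank μ Y₀ U) (ha : 0 ≤ a) (hab : a < b) (hb : b ≤ 1) :
    (∫⁻ u in Set.Ioo a b,
          ENNReal.ofReal ((quantile (μ.map Y₁) (u - a) - quantile (μ.map Y₀) u)⁺)) +
        ∫⁻ ω in {ω | a < U ω ∧ U ω < b}, ENNReal.ofReal ((Y₁ ω - Y₀ ω)⁻) ∂μ ≤
      ∫⁻ ω in {ω | a < U ω ∧ U ω < b}, ENNReal.ofReal ((Y₁ ω - Y₀ ω)⁺) ∂μ +
        ∫⁻ u in Set.Ioo a b,
          ENNReal.ofReal ((quantile (μ.map Y₁) (u - a) - quantile (μ.map Y₀) u)⁻) := by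
  have hQ₀ := aemeasurable_quantile_sub (μ.map Y₀) (a := a) (b := b) (τ := 0) (by simpa) (by simpa)
  simp only [sub_zero] at hQ₀
  have hQ₁ := aemeasurable_quantile_sub (μ.map Y₁) (a := a) (b := b) (τ := a) (by linarith)
    (by linarith)
  rw [lintegral_posPart_sub _ hQ₁ hQ₀, lintegral_negPart_sub _ hQ₁ hQ₀,
    lintegral_posPart_sub _ hY₁.aemeasurable hY₀.aemeasurable,
    lintegral_negPart_sub _ hY₁.aemeasurable hY₀.aemeasurable,
    ← lintegral_add_left (measurable_measure_between _ hQ₁ hQ₀),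
    ← lintegral_add_left (measurable_measure_between _ hY₁.aemeasurable hY₀.aemeasurable)]
  refine lintegral_mono fun z => ?_
  obtain ⟨x, y, p, s, hx, hy, hp, hs, hD, hD', h1, h2, h3, h4⟩ :=
    exists_discordant_masses hY₀ hY₁ hU ha hab hb z
  simp only [hD, hD', volume_quantile_le_lt_quantile_sub _ _ ha hb (by linarith : 0 ≤ a - a)
    (by linarith), volume_quantile_sub_le_lt_quantile _ _ ha hb (by linarith : 0 ≤ a - a)
    (by linarith)]
  refine ENNReal.ofReal_add_le_ofReal_add ?_
  have := cdf_nonneg (μ.map Y₁) z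
  -- Here `x - y = (x + p) - (p + y)` with `x + p` fixed and `p + y ≤ min (F₁ z) (b - a)`; the
  -- quantile coupling attains equality.
  rw [max_eq_left hx, max_eq_left hy, max_eq_right (by linarith : a ≤ a + cdf (μ.map Y₁) z)]
  grind

/-- The upper bound on the mean effect in a form that makes sense without moment assumptions. -/
theorem lintegral_add_le_quantile_const_sub (hY₀ : Measurable Y₀) (hY₁ : Measurable Y₁)
    (hU : IsNormalizedRank μ Y₀ U) (ha : 0 ≤ a) (hab : a < b) (hb : b ≤ 1) :
    ∫⁻ ω in {ω | a < U ω ∧ U ω < b}, ENNReal.ofReal ((Y₁ ω - Y₀ ω)⁺) ∂μ +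
        ∫⁻ u in Set.Ioo a b,
          ENNReal.ofReal ((quantile (μ.map Y₁) (1 + a - u) - quantile (μ.map Y₀) u)⁻) ≤
      (∫⁻ u in Set.Ioo a b,
          ENNReal.ofReal ((quantile (μ.map Y₁) (1 + a - u) - quantile (μ.map Y₀) u)⁺)) +
        ∫⁻ ω in {ω | a < U ω ∧ U ω < b}, ENNReal.ofReal ((Y₁ ω - Y₀ ω)⁻) ∂μ := by
  have hQ₀ := aemeasurable_quantile_sub (μ.map Y₀) (a := a) (b := b) (τ := 0) (by simpa) (by simpa)
  simp only [sub_zero] at hQ₀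
  have hQ₁ := aemeasurable_quantile_const_sub (μ.map Y₁) (a := a) (b := b) (τ := 1 + a)
    (by linarith) (by linarith)
  rw [lintegral_posPart_sub _ hQ₁ hQ₀, lintegral_negPart_sub _ hQ₁ hQ₀,
    lintegral_posPart_sub _ hY₁.aemeasurable hY₀.aemeasurable,
    lintegral_negPart_sub _ hY₁.aemeasurable hY₀.aemeasurable,
    ← lintegral_add_left (measurable_measure_between _ hQ₁ hQ₀),
    ← lintegral_add_left (measurable_measure_between _ hY₁.aemeasurable hY₀.aemeasurable)]
  refine lintegral_mono fun z => ?_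
  obtain ⟨x, y, p, s, hx, hy, hp, hs, hD, hD', h1, h2, h3, h4⟩ :=
    exists_discordant_masses hY₀ hY₁ hU ha hab hb z
  simp only [hD, hD', volume_quantile_le_lt_quantile_const_sub _ _ ha hb
    (by linarith : 0 ≤ 1 + a - b) (by linarith), volume_quantile_const_sub_le_lt_quantile _ _ ha hb
    (by linarith : 0 ≤ 1 + a - b) (by linarith)]
  refine ENNReal.ofReal_add_le_ofReal_add ?_
  have := cdf_le_one (μ.map Y₁) z
  -- Now `p + y = (b - a) - (x + s)` is at least `0` and at least `(b - a) - (1 - F₁ z)`, which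
  -- bounds `x - y` from above.
  rw [max_eq_left hx, max_eq_left hy]
  grind

end Rank

/-! ### Conditioning on low ranks, and the integrable case. -/

section Rank

variable {Ω : Type*} [MeasurableSpace Ω] {μ : Measure Ω} {Y₀ Y₁ U : Ω → ℝ}

/-- Since `U > 0` almost surely, conditioning on `U < b` is the case `a = 0`, normalized by its mass
`b`. -/
theorem IsNormalizedRank.cond_eq (hU : IsNormalizedRank μ Y₀ U) {b : ℝ} (hb : 0 < b)
    (hb1 : b ≤ 1) :
    μ[|{ω | U ω < b}] = ENNReal.ofReal (1 / b) • μ.restrict {ω | 0 < U ω ∧ U ω < b} := by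
  have hset : ({ω | U ω < b} : Set Ω) =ᵐ[μ] {ω | 0 < U ω ∧ U ω < b} := by
    filter_upwards [hU.ae_mem_Ioo] with ω h
    exact propext (show _ ↔ _ ∧ _ from ⟨fun h' => ⟨h.1, h'⟩, And.right⟩)
  rw [ProbabilityTheory.cond, measure_congr hset, Measure.restrict_congr_set hset,
    hU.measure_subgroup le_rfl hb1, sub_zero, one_div, ENNReal.ofReal_inv_of_pos hb]

variable [IsProbabilityMeasure μ]

theorem integral_bounds_subgroup (hY₀ : Measurable Y₀) (hY₁ : Measurable Y₁)
    (hU : IsNormalizedRank μ Y₀ U) {a b : ℝ} (ha : 0 ≤ a) (hab : a < b) (hb : b ≤ 1)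
    (hi₀ : Integrable Y₀ μ) (hi₁ : Integrable Y₁ μ) :
    IntervalIntegrable (fun u => quantile (μ.map Y₁) (u - a) - quantile (μ.map Y₀) u)
        volume a b ∧
      IntervalIntegrable (fun u => quantile (μ.map Y₁) (1 + a - u) - quantile (μ.map Y₀) u)
        volume a b ∧
      ∫ u in a..b, (quantile (μ.map Y₁) (u - a) - quantile (μ.map Y₀) u) ≤
        ∫ ω in {ω | a < U ω ∧ U ω < b}, (Y₁ ω - Y₀ ω) ∂μ ∧
      ∫ ω in {ω | a < U ω ∧ U ω < b}, (Y₁ ω - Y₀ ω) ∂μ ≤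
        ∫ u in a..b, (quantile (μ.map Y₁) (1 + a - u) - quantile (μ.map Y₀) u) := by
  have hq : ∀ {Y : Ω → ℝ}, Measurable Y → Integrable Y μ →
      IntervalIntegrable (quantile (μ.map Y)) volume 0 1 := fun {Y} hY hi => by
    have := Measure.isProbabilityMeasure_map (μ := μ) hY.aemeasurable
    exact intervalIntegrable_quantile _
      ((integrable_map_measure aestronglyMeasurable_id hY.aemeasurable).2 hi)
  have hsub : ∀ {c d : ℝ}, 0 ≤ c → c ≤ d → d ≤ 1 → Set.uIcc c d ⊆ Set.uIcc (0 : ℝ) 1 := by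
    intro c d hc hcd hd
    rw [Set.uIcc_of_le hcd, Set.uIcc_of_le zero_le_one]
    exact Set.Icc_subset_Icc hc hd
  have h₀ : IntervalIntegrable (quantile (μ.map Y₀)) volume a b :=
    (hq hY₀ hi₀).mono_set (hsub ha hab.le hb)
  have hL : IntervalIntegrable (fun u => quantile (μ.map Y₁) (u - a)) volume a b := by
    have := ((hq hY₁ hi₁).mono_set
      (hsub le_rfl (by linarith : 0 ≤ b - a) (by linarith))).comp_sub_right a
    simpa using this
  have hR : IntervalIntegrable (fun u => quantile (μ.map Y₁) (1 + a - u)) volume a b := by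
    have := ((hq hY₁ hi₁).mono_set
      (hsub (by linarith : 0 ≤ 1 + a - b) (by linarith : 1 + a - b ≤ 1) le_rfl)).comp_sub_left
        (1 + a)
    simpa using this.symm
  have hD : Integrable (fun ω => Y₁ ω - Y₀ ω) (μ.restrict {ω | a < U ω ∧ U ω < b}) :=
    (hi₁.sub hi₀).restrict
  refine ⟨hL.sub h₀, hR.sub h₀, ?_, ?_⟩
  · rw [intervalIntegral.integral_of_le hab.le, integral_Ioc_eq_integral_Ioo]
    exact integral_le_integral_of_add_le
      ((intervalIntegrable_iff_integrableOn_Ioo_of_le hab.le).1 (hL.sub h₀)) hD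
      (lintegral_quantile_sub_add_le hY₀ hY₁ hU ha hab hb)
  · rw [intervalIntegral.integral_of_le hab.le, integral_Ioc_eq_integral_Ioo]
    exact integral_le_integral_of_add_le hD
      ((intervalIntegrable_iff_integrableOn_Ioo_of_le hab.le).1 (hR.sub h₀))
      (lintegral_add_le_quantile_const_sub hY₀ hY₁ hU ha hab hb)

end Rank

/-! ### Assembly of the bounds. -/

theorem theorem2 {Ω : Type*} [MeasurableSpace Ω] (μ : Measure Ω) [IsProbabilityMeasure μ]
    (Y₀ Y₁ U : Ω → ℝ) (hY₀ : Measurable Y₀) (hY₁ : Measurable Y₁)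
    (hU : IsNormalizedRank μ Y₀ U)
    (Q₀ Q₁ : ℝ → ℝ) (hQ₀ : Q₀ = quantile (μ.map Y₀)) (hQ₁ : Q₁ = quantile (μ.map Y₁)) :
    (∀ a b : ℝ, 0 ≤ a → a < b → b ≤ 1 →
      -- Bounds on the subgroup treatment effect, outcomes with finite means.
      (Integrable Y₀ μ → Integrable Y₁ μ →
        IntervalIntegrable (fun u => Q₁ (u - a) - Q₀ u) volume a b ∧
        IntervalIntegrable (fun u => Q₁ (1 + a - u) - Q₀ u) volume a b ∧
        ∫ u in a..b, (Q₁ (u - a) - Q₀ u) ≤ ∫ ω in {ω | a < U ω ∧ U ω < b}, (Y₁ ω - Y₀ ω) ∂μ ∧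
        ∫ ω in {ω | a < U ω ∧ U ω < b}, (Y₁ ω - Y₀ ω) ∂μ ≤
          ∫ u in a..b, (Q₁ (1 + a - u) - Q₀ u)) ∧
      -- The same bounds in the extended reals, for arbitrary outcomes, whenever the two sides exist.
      (ExtIntegralExists (μ.restrict {ω | a < U ω ∧ U ω < b}) (fun ω => Y₁ ω - Y₀ ω) →
        (ExtIntegralExists (volume.restrict (Set.Ioo a b)) (fun u => Q₁ (u - a) - Q₀ u) →
          extIntegral (volume.restrict (Set.Ioo a b)) (fun u => Q₁ (u - a) - Q₀ u) ≤
            extIntegral (μ.restrict {ω | a < U ω ∧ U ω < b}) (fun ω => Y₁ ω - Y₀ ω)) ∧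
        (ExtIntegralExists (volume.restrict (Set.Ioo a b)) (fun u => Q₁ (1 + a - u) - Q₀ u) →
          extIntegral (μ.restrict {ω | a < U ω ∧ U ω < b}) (fun ω => Y₁ ω - Y₀ ω) ≤
            extIntegral (volume.restrict (Set.Ioo a b)) (fun u => Q₁ (1 + a - u) - Q₀ u))) ∧
      -- Bounds for the positive part, in `[0, ∞]`.
      ∫⁻ u in Set.Ioo a b, ENNReal.ofReal ((Q₁ (u - a) - Q₀ u)⁺) ≤
        ∫⁻ ω in {ω | a < U ω ∧ U ω < b}, ENNReal.ofReal ((Y₁ ω - Y₀ ω)⁺) ∂μ ∧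
      ∫⁻ ω in {ω | a < U ω ∧ U ω < b}, ENNReal.ofReal ((Y₁ ω - Y₀ ω)⁺) ∂μ ≤
        ∫⁻ u in Set.Ioo a b, ENNReal.ofReal ((Q₁ (1 + a - u) - Q₀ u)⁺) ∧
      -- Bounds for the negative part, in `[0, ∞]`.
      ∫⁻ u in Set.Ioo a b, ENNReal.ofReal ((Q₁ (1 - b + u) - Q₀ u)⁻) ≤
        ∫⁻ ω in {ω | a < U ω ∧ U ω < b}, ENNReal.ofReal ((Y₁ ω - Y₀ ω)⁻) ∂μ ∧
      ∫⁻ ω in {ω | a < U ω ∧ U ω < b}, ENNReal.ofReal ((Y₁ ω - Y₀ ω)⁻) ∂μ ≤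
        ∫⁻ u in Set.Ioo a b, ENNReal.ofReal ((Q₁ (b - u) - Q₀ u)⁻)) ∧
    -- The integrated quantile treatment effect and the mean effect conditional on `U < b`.
    (∀ b : ℝ, 0 < b → b ≤ 1 →
      (Integrable Y₀ μ → Integrable Y₁ μ →
        1 / b * ∫ u in (0 : ℝ)..b, (Q₁ u - Q₀ u) ≤ ∫ ω, (Y₁ ω - Y₀ ω) ∂(μ[|{ω | U ω < b}]) ∧
        ∫ ω, (Y₁ ω - Y₀ ω) ∂(μ[|{ω | U ω < b}]) ≤
          1 / b * ∫ u in (0 : ℝ)..b, (Q₁ (1 - u) - Q₀ u)) ∧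
      (ExtIntegralExists (μ[|{ω | U ω < b}]) (fun ω => Y₁ ω - Y₀ ω) →
        (ExtIntegralExists (volume.restrict (Set.Ioo 0 b)) (fun u => Q₁ u - Q₀ u) →
          ((1 / b : ℝ) : EReal) *
              extIntegral (volume.restrict (Set.Ioo 0 b)) (fun u => Q₁ u - Q₀ u) ≤
            extIntegral (μ[|{ω | U ω < b}]) (fun ω => Y₁ ω - Y₀ ω)) ∧
        (ExtIntegralExists (volume.restrict (Set.Ioo 0 b)) (fun u => Q₁ (1 - u) - Q₀ u) →
          extIntegral (μ[|{ω | U ω < b}]) (fun ω => Y₁ ω - Y₀ ω) ≤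
            ((1 / b : ℝ) : EReal) *
              extIntegral (volume.restrict (Set.Ioo 0 b)) (fun u => Q₁ (1 - u) - Q₀ u)))) := by
  subst hQ₀ hQ₁
  refine ⟨fun a b ha hab hb => ⟨integral_bounds_subgroup hY₀ hY₁ hU ha hab hb, fun hD =>
    ⟨fun hq => extIntegral_le_of_add_le hq hD (lintegral_quantile_sub_add_le hY₀ hY₁ hU ha hab hb),
      fun hq => extIntegral_le_of_add_le hD hq
        (lintegral_add_le_quantile_const_sub hY₀ hY₁ hU ha hab hb)⟩,
    lintegral_posPart_quantile_sub_le hY₀ hY₁ hU ha hab hb,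
    lintegral_posPart_le_quantile_const_sub hY₀ hY₁ hU ha hab hb, ?_,
    lintegral_negPart_le_quantile_const_sub hY₀ hY₁ hU ha hab hb⟩, fun b hb0 hb => ?_⟩
  · have e : ∀ u : ℝ, 1 - b + u = u - (b - 1) := fun u => by ring
    simp only [e]
    exact lintegral_negPart_quantile_sub_le hY₀ hY₁ hU ha hab hb
  · have hb' : 0 < 1 / b := one_div_pos.2 hb0
    have hlow := lintegral_quantile_sub_add_le hY₀ hY₁ hU le_rfl hb0 hb
    have hupp := lintegral_add_le_quantile_const_sub hY₀ hY₁ hU le_rfl hb0 hb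
    simp only [sub_zero, add_zero] at hlow hupp
    rw [hU.cond_eq hb0 hb]
    refine ⟨fun hi₀ hi₁ => ?_, fun hD => ?_⟩
    · obtain ⟨-, -, h₁, h₂⟩ := integral_bounds_subgroup hY₀ hY₁ hU le_rfl hb0 hb hi₀ hi₁
      simp only [sub_zero, add_zero] at h₁ h₂
      rw [integral_smul_measure, ENNReal.toReal_ofReal hb'.le, smul_eq_mul]
      exact ⟨mul_le_mul_of_nonneg_left h₁ hb'.le, mul_le_mul_of_nonneg_left h₂ hb'.le⟩
    · rw [extIntegralExists_smul_iff (ENNReal.ofReal_pos.2 hb').ne' ENNReal.ofReal_ne_top] at hD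
      have hc : (0 : EReal) ≤ ((1 / b : ℝ) : EReal) := by exact_mod_cast hb'.le
      rw [extIntegral_smul hb'.le]
      exact ⟨fun hq => mul_le_mul_of_nonneg_left (extIntegral_le_of_add_le hq hD hlow) hc,
        fun hq => mul_le_mul_of_nonneg_left (extIntegral_le_of_add_le hD hq hupp) hc⟩
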